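/- **Games with disturbances.** An arena $(V,V_0,V_1,E,D)$ consists of a countable vertex set $V$ partitioned into the vertices $V_0$ of Player $0$ and $V_1$ of Player $1$, standard edges $E\subseteq V\times V$ such that every vertex has an $E$-successor, and disturbance edges $D\subseteq V_0\times V$. A play is a sequence $(v_0,b_0)(v_1,b_1)\cdots\in(V\times\{0,1\})^\omega$ with $b_0=0$ such that, for all $j>0$, $(v_{j-1},v_j)\in E$ if $b_j=0$ and $(v_{j-1},v_j)\in D$ if $b_j=1$; its number of disturbances is $|\{j : b_j=1\}|\in\omega+1$. A strategy for Player $0$ is a function $\sigma\colon V^*V_0\to V$ with $(v_j,\sigma(v_0\cdots v_j))\in E$; a play is consistent with $\sigma$ if $v_{j+1}=\sigma(v_0\cdots v_j)$ whenever $v_j\in V_0$ and $b_{j+1}=0$. For an ordinal $\alpha<\omega+2$, $\sigma$ is $\alpha$-resilient from $v$ if every play that starts in $v$, is consistent with $\sigma$ and has fewer than $\alpha$ disturbances is winning for Player $0$. The resilience of $v$ is $$r_{\mathcal G}(v)=\sup\{\alpha\in\omega+2 : \text{Player }0\text{ has an }\alpha\text{-resilient strategy from }v\}.$$ **Pushdown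 safety games.** A pushdown system $\mathcal P=(Q,\Gamma,\mathcal E,q_I)$ has a finite set $Q$ of states, an initial state $q_I\in Q$, a finite nonempty stack alphabet $\Gamma$, a bottom symbol $\bot\notin\Gamma$ (write $\Gamma_\bot=\Gamma\cup\{\bot\}$), and a relation $\mathcal E\subseteq Q\times\Gamma_\bot\times Q\times\Gamma_\bot^{\le 2}$ that neither writes nor deletes $\bot$ and is deadlock-free: for all $(q,A)\in Q\times\Gamma_\bot$ there is some $(q,A,q',w)\in\mathcal E$. A configuration is a pair $(q,\gamma)$ with $q\in Q$ and $\gamma\in\Gamma^*\bot$ (top symbol first), and a transition $(q,A,q',w)$ leads from $(q,A\gamma')$ to $(q',w\gamma')$. It is a one-counter system if $|\Gamma|=1$. Its size is $|\mathcal P|=|Q|+|\Gamma|$. A pushdown safety game is given by $\mathcal P$, a partition $Q=Q_0\uplus Q_1$, a relation $\Delta\subseteq Q_0\times\Gamma_\bot\times Q\times\Gamma_\bot^{\le2}$ that neither writes nor deletes $\bot$, and a set $F\subseteq Q$. Its vertices are the configurations, owned according to their states; $\mathcal E$ induces the standard edges and $\Delta$ the disturbance edges; Player $0$ wins a play iff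 no configuration with a state in $F$ is visited. The initial vertex is $v_I=(q_I,\bot)$. **The bound.** The rigged pushdown system $\mathcal P_{\mathrm{rig}}$ gives Player $1$ control over disturbances: at a state $q\in Q_0$, Player $1$ either simulates a transition of $\Delta$ from $q$ to $q'$, passing through an auxiliary state, or moves to a copy $\overline q$ of $q$, from which Player $0$ takes a transition of $\mathcal E$; transitions of $\mathcal E$ from a state $q\in Q_1$ to $q'$ also pass through an auxiliary state. Its stack alphabet is $\Gamma$ and its state set is the disjoint union $$Q' = Q\uplus\{\overline q : q\in Q_0\}\uplus\{(q,q') : (q,A,q',w)\in\Delta\text{ for some }A,w\}\uplus\{(q,q') : q\in Q_1,\ (q,A,q',w)\in\mathcal E\text{ for some }A,w\},$$ so $|Q'|$ is at most quadratic in $|Q|$. Define $$h(\mathcal P)=|Q'|\cdot|\Gamma|\cdot2^{|Q'|+1}+1,\qquad b(\mathcal P)=|Q'|\cdot h(\mathcal P)\cdot|\Gamma|^{h(\mathcal P)}.$$ **Theorem.** Let $\mathcal G$ be a pushdown safety game with initial vertex $v_I$ and underlying pushdown system $\mathcal P$. If $r_{\mathcal G}(v_I)\neq\omega+1$, then $r_{\mathcal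 G}(v_I)<b(\mathcal P)$. Moreover, $b(\mathcal P)\in 2^{2^{O(|\mathcal P|^2)}}$, and $b(\mathcal P)\in 2^{O(|\mathcal P|^2)}$ if $\mathcal P$ is a one-counter system; that is, there are absolute constants $C,C'$ such that $b(\mathcal P)\le 2^{2^{C|\mathcal P|^2}}$ for all pushdown safety games, and $b(\mathcal P)\le 2^{C'|\mathcal P|^2}$ for all those whose underlying system is one-counter. -/

import Mathlib

universe u v

/-! ### Infinite games with disturbances -/

/-- An arena with unmodeled intermittent disturbances on a countable vertex set `V`.
`V0` is the set of vertices of Player 0; the vertices of Player 1 are its complement. -/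
structure Arena (V : Type*) where
  countable : Countable V
  V0 : Set V
  /-- standard edges -/
  E : V → V → Prop
  /-- disturbance edges -/
  D : V → V → Prop
  D_source : ∀ v v', D v v' → v ∈ V0
  exists_succ : ∀ v, ∃ v', E v v'

namespace Arena

variable {V : Type*}

/-- A play `(v 0, b 0) (v 1, b 1) …`; the bit `b j` is `true` if the `j`-th vertex was reached
through a disturbance edge. -/
structure Play (A : Arena V) where
  v : ℕ → V
  b : ℕ → Bool
  b_zero : b 0 = false
  std : ∀ j, b (j + 1) = false → A.E (v j) (v (j + 1))
  dist : ∀ j, b (j + 1) = true → A.D (v j) (v (j + 1))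

/-- The number of disturbances in a play, a natural number or `ω`
(a cardinal, viewed as an initial ordinal). -/
noncomputable def Play.disturbances {A : Arena V} (ρ : A.Play) : Ordinal.{0} :=
  (Cardinal.mk {j : ℕ // ρ.b j = true}).ord

/-- A strategy for Player 0: given the history `h` of vertices visited before, and the current
vertex `v` of Player 0, it selects a successor of `v` along a standard edge. -/
structure Strategy (A : Arena V) where
  move : List V → A.V0 → V
  legal : ∀ (h : List V) (v : A.V0), A.E v (move h v)

/-- The play follows the strategy whenever Player 0 is to move and no disturbance occurs. -/
def Play.ConsistentWith {A : Arena V} (ρ : A.Play) (σ : A.Strategy) : Prop :=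
  ∀ (j : ℕ) (hj : ρ.v j ∈ A.V0), ρ.b (j + 1) = false →
    ρ.v (j + 1) = σ.move ((List.range j).map ρ.v) ⟨ρ.v j, hj⟩

end Arena

/-- A game with disturbances: an arena and a winning condition for Player 0. -/
structure DistGame (V : Type*) where
  arena : Arena V
  Win : Set (ℕ → V)

namespace DistGame

variable {V : Type*}

/-- `σ` is `α`-resilient from `v₀`: every consistent play from `v₀` with fewer than `α`
disturbances is winning for Player 0. -/
def IsResilient (G : DistGame V) (σ : G.arena.Strategy) (α : Ordinal.{0}) (v₀ : V) : Prop :=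
  ∀ ρ : G.arena.Play, ρ.v 0 = v₀ → ρ.ConsistentWith σ → ρ.disturbances < α → ρ.v ∈ G.Win

/-- The resilience of a vertex: the supremum of all ordinals `α ∈ ω + 2` such that Player 0 has
an `α`-resilient strategy from it. -/
noncomputable def resilience (G : DistGame V) (v₀ : V) : Ordinal.{0} :=
  sSup {α | α < Ordinal.omega0 + 2 ∧ ∃ σ : G.arena.Strategy, G.IsResilient σ α v₀}

end DistGame

/-- The safety condition: never visit `F`. -/
def SafetyCond {V : Type*} (F : Set V) : Set (ℕ → V) := {v | ∀ j, v j ∉ F}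

/-! ### Pushdown systems and pushdown safety games

Stack symbols with the bottom symbol are elements of `Option Γ`, where `none` is the bottom
symbol. -/

/-- A transition relation, consisting of tuples `(q, A, q', w)`. -/
abbrev TransRel (Q Γ : Type*) := Set (Q × Option Γ × Q × List (Option Γ))

/-- Every transition replaces the topmost symbol by a word of length at most two, and the bottom
symbol is neither written nor deleted: it is replaced by a word of the form `u ⊥` with `u ∈ Γ*`,
and any other symbol is replaced by a word `u ∈ Γ*`. -/
def TransRel.Valid {Q Γ : Type*} (T : TransRel Q Γ) : Prop :=
  ∀ q A q' w, (q, A, q', w) ∈ T → w.length ≤ 2 ∧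
    (A = none → ∃ u : List Γ, w = u.map some ++ [none]) ∧
    (A ≠ none → ∃ u : List Γ, w = u.map some)

/-- A (deadlock-free) pushdown system with set of states `Q` and stack alphabet `Γ`. -/
structure PDS (Q Γ : Type*) where
  trans : TransRel Q Γ
  init : Q
  valid : trans.Valid
  deadlock_free : ∀ (q : Q) (A : Option Γ), ∃ q' w, (q, A, q', w) ∈ trans

/-- The configuration `(q, γ)` stands for state `q` and stack content `γ ⊥`, top symbol first. -/
abbrev Config (Q Γ : Type*) := Q × List Γ

/-- The stack content `γ ⊥` as a word over `Γ ∪ {⊥}`. -/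
def stackWord {Γ : Type*} (γ : List Γ) : List (Option Γ) := γ.map some ++ [none]

/-- The one-step relation between configurations induced by a transition relation. -/
def TransRel.Step {Q Γ : Type*} (T : TransRel Q Γ) (c c' : Config Q Γ) : Prop :=
  ∃ A w rest, (c.1, A, c'.1, w) ∈ T ∧ stackWord c.2 = A :: rest ∧ stackWord c'.2 = w ++ rest

theorem PDS.exists_step {Q Γ : Type*} (P : PDS Q Γ) (c : Config Q Γ) :
    ∃ c', P.trans.Step c c' := by
  obtain ⟨q, γ⟩ := c
  cases γ with
  | nil =>
    obtain ⟨q', w, h⟩ := P.deadlock_free q none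
    obtain ⟨u, rfl⟩ := (P.valid _ _ _ _ h).2.1 rfl
    exact ⟨(q', u), none, _, [], h, by simp [stackWord], by simp [stackWord]⟩
  | cons a r =>
    obtain ⟨q', w, h⟩ := P.deadlock_free q (some a)
    obtain ⟨u, rfl⟩ := (P.valid _ _ _ _ h).2.2 (by simp)
    exact ⟨(q', u ++ r), some a, _, stackWord r, h, by simp [stackWord], by simp [stackWord]⟩

/-- The data of a pushdown safety game: a pushdown system, the states of Player 0 (the remaining
states belong to Player 1), the transition relation `Δ` inducing the disturbance edges, and the
set `F` of states to be avoided. -/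
structure PushdownSafetyGame (Q Γ : Type*) where
  pds : PDS Q Γ
  Q0 : Set Q
  Δ : TransRel Q Γ
  Δ_valid : Δ.Valid
  Δ_source : ∀ q A q' w, (q, A, q', w) ∈ Δ → q ∈ Q0
  F : Set Q

namespace PushdownSafetyGame

variable {Q Γ : Type*}

/-- The pushdown arena induced by the data. -/
def arena [Finite Q] [Finite Γ] (G : PushdownSafetyGame Q Γ) : Arena (Config Q Γ) where
  countable := inferInstance
  V0 := {c | c.1 ∈ G.Q0}
  E := G.pds.trans.Step
  D := G.Δ.Step
  D_source := fun _ _ ⟨_, _, _, h, _⟩ => G.Δ_source _ _ _ _ h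
  exists_succ := G.pds.exists_step

/-- The induced game. -/
def toGame [Finite Q] [Finite Γ] (G : PushdownSafetyGame Q Γ) : DistGame (Config Q Γ) where
  arena := G.arena
  Win := SafetyCond {c | c.1 ∈ G.F}

/-- The initial vertex `(q_I, ⊥)`. -/
def initVertex (G : PushdownSafetyGame Q Γ) : Config Q Γ := (G.pds.init, [])

/-! ### The rigged pushdown system

In the rigged game Player 1 controls the disturbances. At a vertex of Player 0, Player 1 either
simulates a disturbance edge, via an auxiliary vertex, or moves to a copy of the vertex at which
Player 0 picks a standard edge. Moves of Player 1 are subdivided by an auxiliary vertex. -/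

/-- The states of the rigged pushdown system. -/
inductive RigState (G : PushdownSafetyGame Q Γ)
  /-- an original state -/
  | orig (q : Q)
  /-- the copy of a state of Player 0 at which she picks a standard transition -/
  | copy (q : Q) (h : q ∈ G.Q0)
  /-- the auxiliary state visited when a disturbance from `q` to `q'` is simulated -/
  | dist (q q' : Q) (h : ∃ A w, (q, A, q', w) ∈ G.Δ)
  /-- the auxiliary state visited when Player 1 moves from `q` to `q'` -/
  | move (q q' : Q) (h : q ∉ G.Q0 ∧ ∃ A w, (q, A, q', w) ∈ G.pds.trans)

/-- The transitions of the rigged pushdown system. -/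
inductive RigTrans (G : PushdownSafetyGame Q Γ) :
    G.RigState → Option Γ → G.RigState → List (Option Γ) → Prop
  | dist_start (q A q' w) (h : (q, A, q', w) ∈ G.Δ) :
      RigTrans G (.orig q) A (.dist q q' ⟨A, w, h⟩) w
  | dist_end (q q' h A) : RigTrans G (.dist q q' h) A (.orig q') [A]
  | no_dist (q) (h : q ∈ G.Q0) (A) : RigTrans G (.orig q) A (.copy q h) [A]
  | choose (q) (h : q ∈ G.Q0) (A q' w) (ht : (q, A, q', w) ∈ G.pds.trans) :
      RigTrans G (.copy q h) A (.orig q') w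
  | move_start (q) (h : q ∉ G.Q0) (A q' w) (ht : (q, A, q', w) ∈ G.pds.trans) :
      RigTrans G (.orig q) A (.move q q' ⟨h, A, w, ht⟩) w
  | move_end (q q' h A) : RigTrans G (.move q q' h) A (.orig q') [A]

/-- The rigged pushdown system; its stack alphabet is still `Γ`. -/
def rig (G : PushdownSafetyGame Q Γ) : PDS G.RigState Γ where
  trans := {t | G.RigTrans t.1 t.2.1 t.2.2.1 t.2.2.2}
  init := .orig G.pds.init
  valid := by
    have key : ∀ A : Option Γ, ([A] : List (Option Γ)).length ≤ 2 ∧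
        (A = none → ∃ u : List Γ, [A] = u.map some ++ [none]) ∧
        (A ≠ none → ∃ u : List Γ, [A] = u.map some) := by
      intro A
      refine ⟨by simp, fun h => ⟨[], by simp [h]⟩, fun h => ?_⟩
      obtain ⟨a, rfl⟩ := Option.ne_none_iff_exists'.mp h
      exact ⟨[a], rfl⟩
    rintro s A s' w h
    change G.RigTrans s A s' w at h
    cases h
    all_goals first
      | exact key A
      | exact G.Δ_valid _ _ _ _ (by assumption)
      | exact G.pds.valid _ _ _ _ (by assumption)
  deadlock_free := by
    intro s A
    cases s with
    | orig q =>
      by_cases hq : q ∈ G.Q0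
      · exact ⟨_, _, .no_dist q hq A⟩
      · obtain ⟨q', w, h⟩ := G.pds.deadlock_free q A
        exact ⟨_, _, .move_start q hq A q' w h⟩
    | copy q hq =>
      obtain ⟨q', w, h⟩ := G.pds.deadlock_free q A
      exact ⟨_, _, .choose q hq A q' w h⟩
    | dist q q' h => exact ⟨_, _, .dist_end q q' h A⟩
    | move q q' h => exact ⟨_, _, .move_end q q' h A⟩

instance [Finite Q] (G : PushdownSafetyGame Q Γ) : Finite G.RigState := by
  let f : G.RigState → Q ⊕ Q ⊕ (Q × Q) ⊕ (Q × Q)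
    | .orig q => .inl q
    | .copy q _ => .inr (.inl q)
    | .dist q q' _ => .inr (.inr (.inl (q, q')))
    | .move q q' _ => .inr (.inr (.inr (q, q')))
  refine Finite.of_injective f ?_
  rintro (_ | _ | _ | _) (_ | _ | _ | _) h <;> simp_all [f]

/-! ### The bound -/

/-- `h = |Q'| · |Γ| · 2 ^ (|Q'| + 1) + 1`, where `Q'` is the state set of the rigged system. -/
noncomputable def heightBound (G : PushdownSafetyGame Q Γ) : ℕ :=
  Nat.card G.RigState * Nat.card Γ * 2 ^ (Nat.card G.RigState + 1) + 1

/-- `b = |Q'| · h · |Γ| ^ h`. -/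
noncomputable def bound (G : PushdownSafetyGame Q Γ) : ℕ :=
  Nat.card G.RigState * G.heightBound * Nat.card Γ ^ G.heightBound

end PushdownSafetyGame

/-- The size of a pushdown system: its number of states plus its number of stack symbols. -/
noncomputable def PDS.size {Q Γ : Type*} (_ : PDS Q Γ) : ℕ := Nat.card Q + Nat.card Γ

/-- A one-counter system is a pushdown system with a single stack symbol. -/
def PDS.IsOneCounter {Q Γ : Type*} (_ : PDS Q Γ) : Prop := Nat.card Γ = 1

/-! ### Attractors of Player 1 when she controls the disturbances -/

namespace Arena

variable {V : Type*}

/-! Let Player 1 control the disturbances, and take her attractor of `F` in the original arena.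
Outside it, Player 0 can stay outside positionally whatever disturbances occur, so the resilience is
`ω + 1`.

If the initial vertex lies inside, it suffices that Player 1 can win with bounded stack height. The
attractor restricted to the finitely many configurations of that height is exhausted after at most
as many stages as there are configurations. Each step costs at most one disturbance, so every
strategy of Player 0 loses to some play with at most that many disturbances
(`resilience_le_of_attr`).

The height bound is a pigeonhole argument on the triples `(q, A, S)` for which Player 1 can reach
`F` or pop `A` from `q` into `S` within relative height `n`. These sets grow with `n` inside a set
of size `|Q| · |Γ| · 2 ^ |Q|`, so two consecutive ones agree. At such an `n`, every winning position
can be popped symbol by symbol within height `n` (`popChain_of_attr`). The rigged system enters only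
through `|Q| ≤ |Q'|`. -/

/-- The edges available to Player 1 when she controls the disturbances. -/
def Edge1 (A : Arena V) (c c' : V) : Prop := A.D c c' ∨ (c ∉ A.V0 ∧ A.E c c')

/-- The vertices from which Player 1, controlling the disturbances, can force a visit to `T`
while all vertices seen before belong to `ok`. -/
inductive Attr (A : Arena V) (ok T : Set V) : V → Prop
  | target {c} (h : c ∈ T) : Attr A ok T c
  | pick {c c'} (hok : c ∈ ok) (he : A.Edge1 c c') (h : Attr A ok T c') : Attr A ok T c
  | forced {c} (hok : c ∈ ok) (h0 : c ∈ A.V0) (h : ∀ c', A.E c c' → Attr A ok T c') :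
      Attr A ok T c

/-- The stages of the attractor: `T` can be forced within `n` steps. -/
def stage (A : Arena V) (ok T : Set V) : ℕ → Set V
  | 0 => T
  | n + 1 => {c | c ∈ T ∨ c ∈ ok ∧ ((∃ c', A.Edge1 c c' ∧ c' ∈ stage A ok T n) ∨
      (c ∈ A.V0 ∧ ∀ c', A.E c c' → c' ∈ stage A ok T n))}

theorem stage_le_succ (A : Arena V) (ok T : Set V) (n : ℕ) :
    A.stage ok T n ⊆ A.stage ok T (n + 1) := by
  induction n with
  | zero => exact fun c hc => Or.inl hc
  | succ n ih =>
    rintro c (h | ⟨hok, ⟨c', he, h⟩ | ⟨h0, h⟩⟩)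
    · exact Or.inl h
    · exact Or.inr ⟨hok, Or.inl ⟨c', he, ih h⟩⟩
    · exact Or.inr ⟨hok, Or.inr ⟨h0, fun c' he => ih (h c' he)⟩⟩

theorem stage_subset {A : Arena V} {ok T B : Set V} (hok : ok ⊆ B) (hT : T ⊆ B) (n : ℕ) :
    A.stage ok T n ⊆ B := by
  cases n with
  | zero => exact hT
  | succ n =>
    rintro c (h | ⟨h, -⟩)
    exacts [hT h, hok h]

/-- A stage equal to its successor is closed under the attractor rules, hence contains the least
such set. -/
theorem Attr.mem_stage {A : Arena V} {ok T : Set V} {n : ℕ}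
    (hn : A.stage ok T n = A.stage ok T (n + 1)) {c : V} (h : A.Attr ok T c) :
    c ∈ A.stage ok T n := by
  induction h with
  | target h => exact hn ▸ Or.inl h
  | pick hok he _ ih => exact hn ▸ Or.inr ⟨hok, Or.inl ⟨_, he, ih⟩⟩
  | forced hok h0 _ ih => exact hn ▸ Or.inr ⟨hok, Or.inr ⟨h0, ih⟩⟩

/-- An increasing sequence of subsets of a finite set pauses at an index bounded by the size of
that set. -/
theorem _root_.Set.Finite.exists_eq_succ_of_subset {α : Type*} {B : Set α} (hB : B.Finite)
    (s : ℕ → Set α) (hs : ∀ n, s n ⊆ s (n + 1)) (hsB : ∀ n, s n ⊆ B) :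
    ∃ n ≤ B.ncard, s n = s (n + 1) := by
  by_contra! hne
  -- Without a pause each inclusion is strict, so the cardinality grows by at least one per step.
  have key : ∀ n ≤ B.ncard + 1, n ≤ (s n).ncard := by
    intro n hn
    induction n with
    | zero => exact Nat.zero_le _
    | succ n ih =>
      exact (ih (by omega)).trans_lt (Set.ncard_lt_ncard
        ((hs n).ssubset_of_ne (hne n (by omega))) (hB.subset (hsB _)))
  have := (key _ le_rfl).trans (Set.ncard_le_ncard (hsB _) hB)
  omega

theorem Attr.exists_mem_stage {A : Arena V} {ok T B : Set V} (hB : B.Finite)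
    (hok : ok ⊆ B) (hT : T ⊆ B) {c : V} (h : A.Attr ok T c) :
    ∃ n ≤ B.ncard, c ∈ A.stage ok T n := by
  obtain ⟨n, hn, he⟩ := hB.exists_eq_succ_of_subset (A.stage ok T) (A.stage_le_succ ok T)
    (stage_subset hok hT)
  exact ⟨n, hn, h.mem_stage he⟩

/-! #### Plays in which Player 1 follows her attractor strategy -/

/-- A move from `c` with history `h` that follows `σ`. -/
def LegalMove (A : Arena V) (σ : A.Strategy) (h : List V) (c : V) (c' : V) (b : Bool) : Prop :=
  (b = true → A.D c c') ∧ (b = false → A.E c c') ∧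
    ∀ h0 : c ∈ A.V0, b = false → c' = σ.move h ⟨c, h0⟩

theorem exists_legalMove_false (A : Arena V) (σ : A.Strategy) (h : List V) (c : V) :
    ∃ c', A.LegalMove σ h c c' false := by
  by_cases h0 : c ∈ A.V0
  · exact ⟨σ.move h ⟨c, h0⟩, by simp, fun _ => σ.legal h ⟨c, h0⟩, fun _ _ => rfl⟩
  · obtain ⟨c', he⟩ := A.exists_succ c
    exact ⟨c', by simp, fun _ => he, fun h => absurd h h0⟩

/-- Here `k` is the number of steps left. Player 1 descends one stage per move, and stops causing
disturbances once `k = 0`. -/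
theorem exists_legalMove_stage (A : Arena V) (σ : A.Strategy) (ok T : Set V) (h : List V) (c : V)
    (k : ℕ) :
    ∃ c' b, A.LegalMove σ h c c' b ∧ (k = 0 → b = false) ∧
      ∀ n, k = n + 1 → c ∈ A.stage ok T k → c ∉ T → c' ∈ A.stage ok T n := by
  obtain ⟨d, hd⟩ := A.exists_legalMove_false σ h c
  cases k with
  | zero => exact ⟨d, false, hd, fun _ => rfl, by simp⟩
  | succ n =>
    by_cases hc : c ∈ A.stage ok T (n + 1)
    · obtain hT | ⟨-, ⟨c', hD | ⟨h0, hE⟩, hc'⟩ | ⟨h0, hall⟩⟩ := hc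
      · exact ⟨d, false, hd, by simp, fun _ _ _ h => absurd hT h⟩
      · refine ⟨c', true, ⟨fun _ => hD, by simp, by simp⟩, by simp, ?_⟩
        rintro m hm - -
        obtain rfl : n = m := by omega
        exact hc'
      · refine ⟨c', false, ⟨by simp, fun _ => hE, fun h => absurd h h0⟩, by simp, ?_⟩
        rintro m hm - -
        obtain rfl : n = m := by omega
        exact hc'
      · refine ⟨d, false, hd, by simp, ?_⟩
        rintro m hm - -
        obtain rfl : n = m := by omega
        exact hall _ (hd.2.1 rfl)
    · exact ⟨d, false, hd, by simp, fun _ _ h => absurd h hc⟩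

/-- If `T` can be forced within `n` steps, then every strategy of Player 0 admits a consistent
play with at most `n` disturbances that visits `T`. -/
theorem exists_play_of_mem_stage (A : Arena V) (σ : A.Strategy) {ok T : Set V} {n : ℕ} {c : V}
    (hc : c ∈ A.stage ok T n) :
    ∃ ρ : A.Play, ρ.v 0 = c ∧ ρ.ConsistentWith σ ∧ ρ.disturbances ≤ n ∧ ∃ j, ρ.v j ∈ T := by
  choose nx nb hlegal hzero hstage using A.exists_legalMove_stage σ ok T
  -- The components are history, current vertex and bit; the move at time `j` is made with `n - j`
  -- steps left.
  let st : ℕ → List V × V × Bool := fun j => Nat.rec ([], c, false)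
    (fun j s => (s.1 ++ [s.2.1], nx s.1 s.2.1 (n - j), nb s.1 s.2.1 (n - j))) j
  have hist : ∀ j, (st j).1 = (List.range j).map fun i => (st i).2.1 := by
    intro j
    induction j with
    | zero => rfl
    | succ j ih =>
      rw [List.range_succ, List.map_append, ← ih]
      rfl
  have hl : ∀ j, A.LegalMove σ (st j).1 (st j).2.1 (st (j + 1)).2.1 (st (j + 1)).2.2 :=
    fun j => hlegal _ _ _
  let ρ : A.Play :=
    { v := fun j => (st j).2.1
      b := fun j => (st j).2.2
      b_zero := rfl
      std := fun j => (hl j).2.1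
      dist := fun j => (hl j).1 }
  refine ⟨ρ, rfl, ?_, ?_, ?_⟩
  · intro j hj hb
    have := (hl j).2.2 hj hb
    rw [hist] at this
    exact this
  · have hb : ∀ j : {j // ρ.b j = true}, j.1 - 1 < n ∧ j.1 ≠ 0 := by
      rintro ⟨_ | j, hj⟩
      · exact absurd hj (by simp [ρ.b_zero])
      · refine ⟨?_, by simp⟩
        by_contra hlt
        have hlt' : n ≤ j := by simpa using hlt
        have : (st (j + 1)).2.2 = false := hzero _ _ _ (by omega)
        exact absurd (hj.symm.trans this) (by simp)
    have hinj : Function.Injective fun j : {j // ρ.b j = true} => (⟨j.1 - 1, (hb j).1⟩ : Fin n) := by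
      intro i j hij
      have h1 := (hb i).2
      have h2 := (hb j).2
      have h3 : i.1 - 1 = j.1 - 1 := congrArg Fin.val hij
      exact Subtype.ext (by omega)
    have := Cardinal.mk_le_of_injective hinj
    rw [Play.disturbances, ← Cardinal.ord_natCast]
    exact Cardinal.ord_le_ord.mpr (by simpa using this)
  · by_contra! hT
    have : ∀ j ≤ n, (st j).2.1 ∈ A.stage ok T (n - j) := by
      intro j hj
      induction j with
      | zero => exact hc
      | succ j ih =>
        exact hstage _ _ _ (n - (j + 1)) (by omega) (ih (by omega)) (hT j)
    have h := this n le_rfl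
    rw [Nat.sub_self] at h
    exact hT n h

/-- Player 0 can stay outside the attractor forever, whatever the disturbances. -/
theorem exists_strategy_avoiding (A : Arena V) (T : Set V) :
    ∃ σ : A.Strategy, ∀ ρ : A.Play, ¬ A.Attr Set.univ T (ρ.v 0) → ρ.ConsistentWith σ →
      ∀ j, ¬ A.Attr Set.univ T (ρ.v j) := by
  -- If all successors lay in the attractor, `forced` would put `v` there too.
  have hmove : ∀ v : A.V0, ∃ v', A.E v v' ∧
      (¬ A.Attr Set.univ T v → ¬ A.Attr Set.univ T v') := by
    intro v
    by_cases hv : A.Attr Set.univ T v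
    · obtain ⟨v', h⟩ := A.exists_succ v
      exact ⟨v', h, fun h => absurd hv h⟩
    · by_contra! hall
      exact hv (.forced trivial v.2 fun c' he => (hall c' he).2)
  choose mv hE hA using hmove
  refine ⟨⟨fun _ v => mv v, fun _ v => hE v⟩, fun ρ h0 hcons j => ?_⟩
  induction j with
  | zero => exact h0
  | succ j ih =>
    cases hb : ρ.b (j + 1) with
    | true => exact fun h => ih (.pick trivial (Or.inl (ρ.dist j hb)) h)
    | false =>
      by_cases hj : ρ.v j ∈ A.V0
      · rw [hcons j hj hb]
        exact hA ⟨_, hj⟩ ih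
      · exact fun h => ih (.pick trivial (Or.inr ⟨hj, ρ.std j hb⟩) h)

end Arena

/-! ### Resilience in terms of attractors -/

namespace DistGame

variable {V : Type*}

theorem resilience_eq_of_not_attr {G : DistGame V} {T : Set V} (hW : G.Win = SafetyCond T)
    {v : V} (hv : ¬ G.arena.Attr Set.univ T v) : G.resilience v = Ordinal.omega0 + 1 := by
  obtain ⟨σ, hσ⟩ := G.arena.exists_strategy_avoiding T
  have hlt : Ordinal.omega0 + 1 < Ordinal.omega0 + 2 := by
    gcongr
    exact one_lt_two
  have hgreatest : IsGreatest {α | α < Ordinal.omega0 + 2 ∧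
      ∃ σ : G.arena.Strategy, G.IsResilient σ α v} (Ordinal.omega0 + 1) := by
    refine ⟨⟨hlt, σ, fun ρ h0 hcons _ => ?_⟩, fun α hα => ?_⟩
    · rw [hW]
      intro j hj
      exact hσ ρ (h0 ▸ hv) hcons j (.target hj)
    · have h2 : Ordinal.omega0 + 2 = Order.succ (Ordinal.omega0 + 1) := by
        rw [Order.succ_eq_add_one, add_assoc, one_add_one_eq_two]
      exact Order.lt_succ_iff.mp (h2 ▸ hα.1)
  exact hgreatest.csSup_eq

theorem resilience_le_of_attr {G : DistGame V} {T ok T' B : Set V} (hW : G.Win = SafetyCond T)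
    (hB : B.Finite) (hok : ok ⊆ B) (hT' : T' ⊆ B) (hT : T' ⊆ T) {v : V}
    (hv : G.arena.Attr ok T' v) : G.resilience v ≤ B.ncard := by
  obtain ⟨n, hn, hmem⟩ := hv.exists_mem_stage hB hok hT'
  refine csSup_le' ?_
  rintro α ⟨-, σ, hσ⟩
  obtain ⟨ρ, h0, hcons, hd, j, hj⟩ := G.arena.exists_play_of_mem_stage σ hmem
  by_contra! hlt
  have hn' : (n : Ordinal.{0}) ≤ B.ncard := by exact_mod_cast hn
  have hwin := hσ ρ h0 hcons (hd.trans_lt (hn'.trans_lt hlt))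
  rw [hW] at hwin
  exact hwin j (hT hj)

end DistGame

/-! ### Steps of pushdown systems -/

namespace TransRel

variable {Q Γ : Type*} {T : TransRel Q Γ}

theorem Valid.step_cons (hT : T.Valid) {q : Q} {A : Γ} {γ : List Γ} {c' : Config Q Γ} :
    T.Step (q, A :: γ) c' ↔
      ∃ u : List Γ, u.length ≤ 2 ∧ c'.2 = u ++ γ ∧ (q, some A, c'.1, u.map some) ∈ T := by
  constructor
  · rintro ⟨B, w, rest, h, h1, h2⟩
    simp only [stackWord, List.map_cons, List.cons_append, List.cons.injEq] at h1
    obtain ⟨rfl, rfl⟩ := h1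
    obtain ⟨hlen, -, hw⟩ := hT _ _ _ _ h
    obtain ⟨u, rfl⟩ := hw (by simp)
    refine ⟨u, by simpa using hlen, ?_, h⟩
    rw [stackWord, ← List.append_assoc, ← List.map_append] at h2
    exact (Option.some_injective Γ).list_map (List.append_cancel_right h2)
  · rintro ⟨u, -, hu, h⟩
    exact ⟨some A, u.map some, stackWord γ, h, by simp [stackWord], by simp [stackWord, hu]⟩

theorem Valid.length_le_of_step_nil (hT : T.Valid) {q : Q} {c' : Config Q Γ}
    (h : T.Step (q, []) c') : c'.2.length ≤ 1 := by
  obtain ⟨B, w, rest, h, h1, h2⟩ := h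
  simp only [stackWord, List.map_nil, List.nil_append, List.cons.injEq] at h1
  obtain ⟨rfl, rfl⟩ := h1
  have hlen := (hT _ _ _ _ h).1
  have := congrArg List.length h2
  simp [stackWord] at this
  omega

/-- While the stack above `δ` is nonempty, `δ` does not influence the steps. -/
theorem Valid.step_append (hT : T.Valid) {q : Q} {γ δ : List Γ} (hγ : γ ≠ []) {c' : Config Q Γ} :
    T.Step (q, γ ++ δ) c' ↔ ∃ γ', c' = (c'.1, γ' ++ δ) ∧ T.Step (q, γ) (c'.1, γ') := by
  obtain ⟨A, γ, rfl⟩ := List.exists_cons_of_ne_nil hγ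
  obtain ⟨q', γ'⟩ := c'
  simp only [List.cons_append, hT.step_cons, Prod.mk.injEq, true_and]
  constructor
  · rintro ⟨u, hu, rfl, h⟩
    exact ⟨u ++ γ, by simp, u, hu, rfl, h⟩
  · rintro ⟨γ₁, rfl, u, hu, rfl, h⟩
    exact ⟨u, hu, by simp, h⟩

end TransRel

/-! ### Bounding the stack height -/

namespace PushdownSafetyGame

variable {Q Γ : Type*} [Finite Q] [Finite Γ] (G : PushdownSafetyGame Q Γ)

/-- Player 1 can force, from the stack content `γ` above some fixed stack content, to reach `F`
or to pop `γ` completely, ending in a state of `S`, while the height stays at most `n`. -/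
def Force (n : ℕ) (S : Set Q) (q : Q) (γ : List Γ) : Prop :=
  G.arena.Attr {c | c.2.length ≤ n ∧ c.2 ≠ []}
    {c | c.2.length ≤ n ∧ (c.1 ∈ G.F ∨ c.2 = [] ∧ c.1 ∈ S)} (q, γ)

/-- Player 1 can force a visit to `F` while the height stays at most `n`. -/
def BoundedWin (n : ℕ) (c : Config Q Γ) : Prop :=
  G.arena.Attr {c | c.2.length ≤ n} {c | c.2.length ≤ n ∧ c.1 ∈ G.F} c

variable {G}

theorem edge1_append {q : Q} {γ δ : List Γ} (hγ : γ ≠ []) {c' : Config Q Γ} :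
    G.arena.Edge1 (q, γ ++ δ) c' ↔
      ∃ γ', c' = (c'.1, γ' ++ δ) ∧ G.arena.Edge1 (q, γ) (c'.1, γ') := by
  change G.Δ.Step _ _ ∨ (q ∉ G.Q0 ∧ G.pds.trans.Step _ _) ↔
    ∃ γ', _ ∧ (G.Δ.Step _ _ ∨ (q ∉ G.Q0 ∧ G.pds.trans.Step _ _))
  rw [G.Δ_valid.step_append hγ, G.pds.valid.step_append hγ]
  constructor
  · rintro (⟨γ', h, h'⟩ | ⟨h0, γ', h, h'⟩)
    exacts [⟨γ', h, Or.inl h'⟩, ⟨γ', h, Or.inr ⟨h0, h'⟩⟩]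
  · rintro ⟨γ', h, h' | ⟨h0, h'⟩⟩
    exacts [Or.inl ⟨γ', h, h'⟩, Or.inr ⟨h0, γ', h, h'⟩]

/-- Forcing to pop `γ` can be continued by any attractor strategy from the stack content below. -/
theorem Force.attr_append {n : ℕ} {S : Set Q} {q : Q} {γ : List Γ} (h : G.Force n S q γ)
    {ok T : Set (Config Q Γ)} {δ : List Γ}
    (hok : ∀ q γ, γ.length ≤ n → γ ≠ [] → (q, γ ++ δ) ∈ ok)
    (hF : ∀ q γ, γ.length ≤ n → q ∈ G.F → (q, γ ++ δ) ∈ T)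
    (hS : ∀ s ∈ S, G.arena.Attr ok T (s, δ)) : G.arena.Attr ok T (q, γ ++ δ) := by
  suffices ∀ c, G.arena.Attr {c | c.2.length ≤ n ∧ c.2 ≠ []}
      {c | c.2.length ≤ n ∧ (c.1 ∈ G.F ∨ c.2 = [] ∧ c.1 ∈ S)} c →
      G.arena.Attr ok T (c.1, c.2 ++ δ) from this _ h
  intro c hc
  induction hc with
  | @target c h =>
    obtain ⟨hl, h | ⟨h1, h2⟩⟩ := h
    · exact .target (hF _ _ hl h)
    · rw [h1]
      exact hS _ h2
  | @pick c c' hc he _ ih =>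
    exact .pick (hok _ _ hc.1 hc.2) ((edge1_append (c' := (c'.1, c'.2 ++ δ)) hc.2).2 ⟨c'.2, rfl, he⟩) ih
  | @forced c hc h0 _ ih =>
    refine .forced (hok _ _ hc.1 hc.2) h0 fun c' he => ?_
    obtain ⟨γ', hγ', he'⟩ := (G.pds.valid.step_append hc.2).1 he
    rw [hγ']
    exact ih (c'.1, γ') he'

theorem Force.mono {m n : ℕ} (hmn : m ≤ n) {S S' : Set Q} (hS : S ⊆ S') {q : Q} {γ : List Γ}
    (h : G.Force m S q γ) : G.Force n S' q γ := by
  have := h.attr_append (ok := {c | c.2.length ≤ n ∧ c.2 ≠ []})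
    (T := {c | c.2.length ≤ n ∧ (c.1 ∈ G.F ∨ c.2 = [] ∧ c.1 ∈ S')}) (δ := [])
    (fun q γ h1 h2 => ⟨by simpa using h1.trans hmn, by simpa using h2⟩)
    (fun q γ h1 h2 => ⟨by simpa using h1.trans hmn, Or.inl h2⟩)
    (fun s hs => .target ⟨by simp, Or.inr ⟨rfl, hS hs⟩⟩)
  rwa [List.append_nil] at this

theorem Force.comp {n : ℕ} {S S' : Set Q} {q : Q} {γ : List Γ} {B : Γ} (h : G.Force n S q γ)
    (hS : ∀ s ∈ S, G.Force n S' s [B]) : G.Force (n + 1) S' q (γ ++ [B]) :=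
  h.attr_append
    (fun q γ h1 h2 => ⟨by simpa using h1, by simp⟩)
    (fun q γ h1 h2 => ⟨by simpa using h1, Or.inl h2⟩)
    (fun s hs => (hS s hs).mono n.le_succ subset_rfl)

theorem Force.boundedWin {m n : ℕ} (hmn : m ≤ n) {S : Set Q} {q : Q} {γ : List Γ}
    (h : G.Force m S q γ) (hS : ∀ s ∈ S, G.BoundedWin n (s, [])) : G.BoundedWin n (q, γ) := by
  have := h.attr_append (ok := {c | c.2.length ≤ n}) (T := {c | c.2.length ≤ n ∧ c.1 ∈ G.F})
    (δ := [])
    (fun q γ h1 h2 => by simpa using h1.trans hmn)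
    (fun q γ h1 h2 => ⟨by simpa using h1.trans hmn, h2⟩) hS
  rwa [List.append_nil] at this

variable (G)

/-- The stack can be popped symbol by symbol, with height at most `n` relative to the popped
symbol, such that eventually a state of `S` is reached. -/
def PopChain (n : ℕ) (S : Set Q) : Q → List Γ → Prop
  | q, [] => q ∈ S
  | q, A :: γ => G.Force n {s | PopChain n S s γ} q [A]

variable {G}

/-- Popping the upper of two symbols happens on top of the lower one, which costs one unit of
height; hence `n + 1`. -/
theorem force_of_popChain_append {n : ℕ} {S : Set Q} {q : Q} {γ u : List Γ} (hu : u.length ≤ 2) (h : G.PopChain n S q (u ++ γ)) :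
    G.Force (n + 1) {s | G.PopChain n S s γ} q u := by
  match u, hu with
  | [], _ => exact .target ⟨by simp, Or.inr ⟨rfl, h⟩⟩
  | [B], _ => exact Force.mono n.le_succ subset_rfl h
  | [B, C], _ => exact Force.comp (γ := [B]) h fun s hs => hs

/-- If allowing one more unit of height does not help to pop single symbols, then Player 1 can
win from all winning positions of stack height zero with bounded height. -/
theorem popChain_of_attr {n : ℕ}
    (hn : ∀ q A S, G.Force (n + 1) S q [A] → G.Force n S q [A])
    {c : Config Q Γ} (h : G.arena.Attr Set.univ {c | c.1 ∈ G.F} c) :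
    G.PopChain n {s | G.BoundedWin (n + 1) (s, [])} c.1 c.2 := by
  set S := {s | G.BoundedWin (n + 1) (s, [])}
  -- One step from the empty stack leaves at most one symbol; popping it returns to the empty stack
  -- in a state of `S`, or reaches `F`.
  have hnil : ∀ q γ, γ.length ≤ 1 → G.PopChain n S q γ → G.BoundedWin (n + 1) (q, γ) := by
    intro q γ hl h
    match γ, hl with
    | [], _ => exact h
    | [B], _ => exact Force.boundedWin n.le_succ h fun s hs => hs
  induction h with
  | @target c hF =>
    obtain ⟨q, _ | ⟨A, γ⟩⟩ := c
    · exact .target ⟨by simp, hF⟩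
    · exact hn _ _ _ (.target ⟨by simp, Or.inl hF⟩)
  | @pick c c' _ he _ ih =>
    obtain ⟨q, _ | ⟨A, γ⟩⟩ := c
    · refine .pick (by simp) he (hnil _ _ ?_ ih)
      rcases he with he | ⟨-, he⟩
      exacts [G.Δ_valid.length_le_of_step_nil he, G.pds.valid.length_le_of_step_nil he]
    · have hedge : ∃ u : List Γ, u.length ≤ 2 ∧ c'.2 = u ++ γ ∧
          G.arena.Edge1 (q, [A]) (c'.1, u) := by
        rcases he with he | ⟨h0, he⟩
        · obtain ⟨u, hu, h2, ht⟩ := G.Δ_valid.step_cons.1 he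
          exact ⟨u, hu, h2, Or.inl (G.Δ_valid.step_cons.2 ⟨u, hu, by simp, ht⟩)⟩
        · obtain ⟨u, hu, h2, ht⟩ := G.pds.valid.step_cons.1 he
          exact ⟨u, hu, h2, Or.inr ⟨h0, G.pds.valid.step_cons.2 ⟨u, hu, by simp, ht⟩⟩⟩
      obtain ⟨u, hu, h2, he'⟩ := hedge
      rw [h2] at ih
      -- Popping the word `u` that replaces `A` needs height `n + 1`; the pause `hn` brings this
      -- back to `n`, so the bound does not grow along the induction.
      exact hn _ _ _ (.pick (by simp) he' (force_of_popChain_append hu ih))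
  | @forced c _ h0 _ ih =>
    obtain ⟨q, _ | ⟨A, γ⟩⟩ := c
    · exact .forced (by simp) h0 fun c' he =>
        hnil _ _ (G.pds.valid.length_le_of_step_nil he) (ih c' he)
    · refine hn _ _ _ (.forced (by simp) h0 fun c' he => ?_)
      obtain ⟨u, hu, h2, ht⟩ := G.pds.valid.step_cons.1 he
      have h3 : c'.2 = u := by simpa using h2
      have := ih (c'.1, u ++ γ) (G.pds.valid.step_cons.2 ⟨u, hu, rfl, ht⟩)
      obtain ⟨q', γ'⟩ := c'
      obtain rfl : γ' = u := h3
      exact force_of_popChain_append hu this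

/-- If Player 1, controlling the disturbances, wins from the initial vertex, then she can do so
with a stack height exponential in the number of states. -/
theorem exists_boundedWin (h : G.arena.Attr Set.univ {c | c.1 ∈ G.F} G.initVertex) :
    ∃ n ≤ Nat.card Q * Nat.card Γ * 2 ^ Nat.card Q, G.BoundedWin (n + 1) G.initVertex := by
  obtain ⟨n, hn, he⟩ := (Set.finite_univ (α := Q × Γ × Set Q)).exists_eq_succ_of_subset
    (fun n => {t | G.Force n t.2.2 t.1 [t.2.1]})
    (fun n t ht => Force.mono n.le_succ subset_rfl ht) (fun _ => Set.subset_univ _)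
  -- The initial stack is empty, so the pop chain is by definition the bounded win.
  refine ⟨n, ?_, popChain_of_attr (c := G.initVertex) (fun q A S hF => ?_) h⟩
  · have : Nat.card (Set Q) = 2 ^ Nat.card Q := by
      have := Fintype.ofFinite Q
      simp [Nat.card_eq_fintype_card]
    rw [Set.ncard_univ, Nat.card_prod, Nat.card_prod, this] at hn
    rwa [mul_assoc]
  · have : (q, A, S) ∈ {t : Q × Γ × Set Q | G.Force n t.2.2 t.1 [t.2.1]} := he ▸ hF
    exact this

end PushdownSafetyGame

/-! ### Counting -/

namespace PushdownSafetyGame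

variable {Q Γ : Type*} {G : PushdownSafetyGame Q Γ}

theorem setOf_length_le_subset_range [Nonempty Γ] (H : ℕ) :
    {c : Config Q Γ | c.2.length ≤ H} ⊆ Set.range
      fun t : Fin (H + 1) × Q × (Fin H → Γ) => (t.2.1, (List.ofFn t.2.2).take t.1) := by
  rintro ⟨q, γ⟩ hγ
  have hγ : γ.length ≤ H := hγ
  -- Pad the stack to length `H` with an arbitrary symbol; the recorded length cuts the padding off.
  refine ⟨(⟨γ.length, by omega⟩, q, fun i => (γ[(i : ℕ)]?).getD (Classical.arbitrary Γ)), ?_⟩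
  refine Prod.ext rfl (List.ext_getElem (by simpa using hγ) fun i h1 h2 => ?_)
  simp [h2]

theorem finite_setOf_length_le [Finite Q] [Finite Γ] [Nonempty Γ] (H : ℕ) :
    {c : Config Q Γ | c.2.length ≤ H}.Finite :=
  (Set.finite_range _).subset (setOf_length_le_subset_range H)

theorem ncard_setOf_length_le [Finite Q] [Finite Γ] [Nonempty Γ] (H : ℕ) :
    {c : Config Q Γ | c.2.length ≤ H}.ncard ≤ (H + 1) * (Nat.card Q * Nat.card Γ ^ H) := by
  refine (Set.ncard_le_ncard (setOf_length_le_subset_range H) (Set.finite_range _)).trans ?_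
  rw [← Set.image_univ]
  refine (Set.ncard_image_le Set.finite_univ).trans ?_
  rw [Set.ncard_univ, Nat.card_prod, Nat.card_prod, Nat.card_fun]
  simp

theorem card_le_card_rigState [Finite Q] : Nat.card Q ≤ Nat.card G.RigState :=
  Nat.card_le_card_of_injective RigState.orig fun _ _ h => by injection h

theorem card_rigState_le [Finite Q] : Nat.card G.RigState ≤ 2 * Nat.card Q + 2 * Nat.card Q ^ 2 := by
  let f : G.RigState → Q ⊕ Q ⊕ (Q × Q) ⊕ (Q × Q)
    | .orig q => .inl q
    | .copy q _ => .inr (.inl q)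
    | .dist q q' _ => .inr (.inr (.inl (q, q')))
    | .move q q' _ => .inr (.inr (.inr (q, q')))
  have hf : Function.Injective f := by
    rintro (_ | _ | _ | _) (_ | _ | _ | _) h <;> simp_all [f]
  refine (Nat.card_le_card_of_injective f hf).trans (le_of_eq ?_)
  simp only [Nat.card_sum, Nat.card_prod]
  ring

theorem resilience_lt_bound [Finite Q] [Finite Γ] [Nonempty Γ]
    (h : G.toGame.resilience G.initVertex ≠ Ordinal.omega0 + 1) :
    G.toGame.resilience G.initVertex < (G.bound : Ordinal.{0}) := by
  have hattr : G.arena.Attr Set.univ {c | c.1 ∈ G.F} G.initVertex := by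
    by_contra hnot
    exact h (DistGame.resilience_eq_of_not_attr rfl hnot)
  obtain ⟨n, hn, hwin⟩ := exists_boundedWin hattr
  have hle := DistGame.resilience_le_of_attr (G := G.toGame) (T := {c | c.1 ∈ G.F}) rfl
    (finite_setOf_length_le (n + 1)) subset_rfl (fun _ hc => hc.1) (fun _ hc => hc.2) hwin
  refine hle.trans_lt ?_
  rw [Nat.cast_lt]
  refine (ncard_setOf_length_le (n + 1)).trans_lt ?_
  have : Nonempty Q := ⟨G.pds.init⟩
  have hQ : 0 < Nat.card Q := Nat.card_pos
  have hΓ : 0 < Nat.card Γ := Nat.card_pos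
  have hQ' := card_le_card_rigState (G := G)
  have hn' : n ≤ Nat.card G.RigState * Nat.card Γ * 2 ^ Nat.card G.RigState :=
    hn.trans (by gcongr; norm_num)
  have hN : 2 ≤ Nat.card G.RigState * Nat.card Γ * 2 ^ Nat.card G.RigState := by
    have h1 : 2 ^ 1 ≤ 2 ^ Nat.card G.RigState := Nat.pow_le_pow_right two_pos (by omega)
    have h2 : 0 < Nat.card G.RigState * Nat.card Γ := Nat.mul_pos (by omega) hΓ
    nlinarith
  -- With `N = |Q'| · |Γ| · 2 ^ |Q'|`, the height bound is `2 * N + 1`, while `n + 2 ≤ N + 2 ≤ 2 *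
  -- N`.
  have hh : n + 2 < G.heightBound := by
    rw [heightBound, pow_succ, ← mul_assoc]
    omega
  calc (n + 1 + 1) * (Nat.card Q * Nat.card Γ ^ (n + 1))
      < G.heightBound * (Nat.card Q * Nat.card Γ ^ (n + 1)) := by
        gcongr
    _ ≤ G.heightBound * (Nat.card G.RigState * Nat.card Γ ^ G.heightBound) := by
        gcongr
        omega
    _ = G.bound := by rw [bound]; ring

/-! ### Growth of the bound -/

theorem heightBound_le : G.heightBound ≤ 2 ^ (2 * Nat.card G.RigState + Nat.card Γ + 1) := by
  set q := Nat.card G.RigState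
  set g := Nat.card Γ
  have h1 : q + 1 ≤ 2 ^ q := Nat.lt_two_pow_self
  have h2 : g + 1 ≤ 2 ^ g := Nat.lt_two_pow_self
  have h3 : q * g + 1 ≤ 2 ^ q * 2 ^ g := le_trans (by nlinarith) (Nat.mul_le_mul h1 h2)
  calc G.heightBound = q * g * 2 ^ (q + 1) + 1 := rfl
    _ ≤ (q * g + 1) * 2 ^ (q + 1) := by
        have := Nat.one_le_two_pow (n := q + 1)
        nlinarith
    _ ≤ 2 ^ q * 2 ^ g * 2 ^ (q + 1) := Nat.mul_le_mul_right _ h3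
    _ = 2 ^ (2 * q + g + 1) := by ring

theorem card_rigState_le_size [Finite Q] : Nat.card G.RigState ≤ 4 * G.pds.size ^ 2 := by
  have h1 := card_rigState_le (G := G)
  have h2 : Nat.card Q ≤ G.pds.size := Nat.le_add_right _ _
  have h3 : Nat.card Q ≤ Nat.card Q ^ 2 := Nat.le_self_pow two_ne_zero _
  have h4 : Nat.card Q ^ 2 ≤ G.pds.size ^ 2 := Nat.pow_le_pow_left h2 2
  omega

theorem bound_le [Finite Q] : G.bound ≤ 2 ^ 2 ^ (15 * G.pds.size ^ 2) := by
  have hq := card_rigState_le_size (G := G)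
  have hh := heightBound_le (G := G)
  have : Nonempty Q := ⟨G.pds.init⟩
  have hQ : 0 < Nat.card Q := Nat.card_pos
  have hs : G.pds.size = Nat.card Q + Nat.card Γ := rfl
  have hss : G.pds.size ≤ G.pds.size ^ 2 := Nat.le_self_pow two_ne_zero _
  have hpos : 1 ≤ G.heightBound := Nat.le_add_left _ _
  rw [bound]
  set q := Nat.card G.RigState
  set g := Nat.card Γ
  set H := G.heightBound
  calc q * H * g ^ H ≤ 2 ^ q * 2 ^ H * (2 ^ g) ^ H := by
        gcongr <;> exact Nat.lt_two_pow_self.le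
    _ = 2 ^ (q + H + g * H) := by ring
    _ ≤ 2 ^ ((q + g + 1) * H) := by
        refine Nat.pow_le_pow_right two_pos ?_
        nlinarith
    _ ≤ 2 ^ (2 ^ (q + g) * 2 ^ (2 * q + g + 1)) := by
        refine Nat.pow_le_pow_right two_pos (Nat.mul_le_mul ?_ hh)
        exact Nat.lt_two_pow_self
    _ = 2 ^ 2 ^ (3 * q + 2 * g + 1) := by ring
    -- With `s` the size, `3 * q ≤ 12 * s ^ 2` and `2 * g + 1 ≤ 3 * s ^ 2`.
    _ ≤ 2 ^ 2 ^ (15 * G.pds.size ^ 2) := by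
        refine Nat.pow_le_pow_right two_pos (Nat.pow_le_pow_right two_pos ?_)
        omega

theorem bound_le_of_isOneCounter [Finite Q] (h1 : G.pds.IsOneCounter) :
    G.bound ≤ 2 ^ (14 * G.pds.size ^ 2) := by
  have hq := card_rigState_le_size (G := G)
  have hh := heightBound_le (G := G)
  have hg : Nat.card Γ = 1 := h1
  have hs : G.pds.size = Nat.card Q + Nat.card Γ := rfl
  have hss : G.pds.size ≤ G.pds.size ^ 2 := Nat.le_self_pow two_ne_zero _
  rw [hg] at hh
  rw [bound, hg, one_pow, mul_one]
  calc Nat.card G.RigState * G.heightBound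
      ≤ 2 ^ Nat.card G.RigState * 2 ^ (2 * Nat.card G.RigState + 1 + 1) :=
        Nat.mul_le_mul Nat.lt_two_pow_self.le hh
    _ = 2 ^ (3 * Nat.card G.RigState + 2) := by ring
    _ ≤ 2 ^ (14 * G.pds.size ^ 2) := Nat.pow_le_pow_right two_pos (by omega)

end PushdownSafetyGame

theorem mainTheorem7 :
    (∀ (Q : Type u) (Γ : Type v) [Finite Q] [Finite Γ] [Nonempty Γ]
        (G : PushdownSafetyGame Q Γ),
      G.toGame.resilience G.initVertex ≠ Ordinal.omega0 + 1 →
        G.toGame.resilience G.initVertex < (G.bound : Ordinal.{0})) ∧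
    (∃ C : ℕ, ∀ (Q : Type u) (Γ : Type v) [Finite Q] [Finite Γ] [Nonempty Γ]
        (G : PushdownSafetyGame Q Γ),
      G.bound ≤ 2 ^ 2 ^ (C * G.pds.size ^ 2)) ∧
    (∃ C : ℕ, ∀ (Q : Type u) (Γ : Type v) [Finite Q] [Finite Γ] [Nonempty Γ]
        (G : PushdownSafetyGame Q Γ),
      G.pds.IsOneCounter → G.bound ≤ 2 ^ (C * G.pds.size ^ 2)) :=
  ⟨fun _ _ _ _ _ _ h => PushdownSafetyGame.resilience_lt_bound h,
    ⟨15, fun _ _ _ _ _ _ => PushdownSafetyGame.bound_le⟩,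
    ⟨14, fun _ _ _ _ _ _ h => PushdownSafetyGame.bound_le_of_isOneCounter h⟩⟩
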